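/- Let $k\ge 2$ be an integer and let $p$ be an odd prime not dividing $k$. Let $$F(t)={}_{k-1}F_{k-2}\left(\tfrac1k,\tfrac2k,\ldots,\tfrac{k-1}{k};1,\ldots,1\,\Big|\,t\right)=\sum_{l\ge 0}\frac{(1/k)_l(2/k)_l\cdots((k-1)/k)_l}{(l!)^{k-1}}\,t^l\in\mathbb{Q}[[t]],$$ where $(x)_l=x(x+1)\cdots(x+l-1)$. Then $F(t)$ has constant term $1$ and all its coefficients lie in $\mathbb{Z}_p$, and for every integer $s\ge 1$ the congruence $$\frac{F(t)}{F(t^p)}\equiv\frac{F_{p^s}(t)}{F_{p^{s-1}}(t^p)}\pmod{p^s}$$ holds in $\mathbb{Z}_p[[t]]$. Here $F_m(t)$ denotes the polynomial obtained from $F(t)$ by deleting all terms of degree $\ge m$, and $F_{p^{s-1}}(t^p)$ is obtained from $F_{p^{s-1}}(t)$ by replacing $t$ with $t^p$. -/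

import Mathlib

open scoped Nat

/-- The generalized hypergeometric series `_mF_n(a; b | t)` as a formal power series: the
coefficient of `t ^ l` is `∏ i, (a i)_l / ((∏ j, (b j)_l) * l !)`, where `(x)_l` is the rising
factorial `x (x + 1) ⋯ (x + l - 1)`. -/
noncomputable def hypergeometricSeries {K : Type*} [Field K] {m n : ℕ}
    (a : Fin m → K) (b : Fin n → K) : PowerSeries K :=
  PowerSeries.mk fun l =>
    (∏ i, (ascPochhammer K l).eval (a i)) / ((∏ j, (ascPochhammer K l).eval (b j)) * (l ! : K))

/-- The series `_{k-1}F_{k-2}(1/k, 2/k, …, (k-1)/k; 1, …, 1 | t)` with rational coefficients. -/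
noncomputable def hypergeometricFracSeries (k : ℕ) : PowerSeries ℚ :=
  hypergeometricSeries (fun i : Fin (k - 1) => ((i : ℕ) + 1 : ℚ) / (k : ℚ))
    (fun _ : Fin (k - 2) => (1 : ℚ))

/-- The quotient `F / G` of power series over `R`, for `G` with constant term `1`. -/
noncomputable def seriesQuotient {R : Type*} [CommRing R] (F G : PowerSeries R) :
    PowerSeries R :=
  F * PowerSeries.invOfUnit G 1

/-- The congruence `F(t) / F(t ^ p) ≡ F_{p ^ s}(t) / F_{p ^ (s - 1)}(t ^ p) mod p ^ s` in
`ℤ_p⟦t⟧`, for a power series `F` with constant term `1`. Here `F_m` is the polynomial obtained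
from `F` by deleting all terms of degree at least `m`. -/
def DworkCongruence (p : ℕ) [hp : Fact p.Prime] (F : PowerSeries ℤ_[p]) (s : ℕ) : Prop :=
  (p : PowerSeries ℤ_[p]) ^ s ∣
    seriesQuotient F (PowerSeries.expand p hp.out.ne_zero F) -
      seriesQuotient (PowerSeries.trunc (p ^ s) F : PowerSeries ℤ_[p])
        (PowerSeries.expand p hp.out.ne_zero
          (PowerSeries.trunc (p ^ (s - 1)) F : PowerSeries ℤ_[p]))

/-! The coefficients of `F` are `A n = (kn)! / (n! ^ k * k ^ (kn))`. By
`exists_padicInt_equalMultinomial`, the ratio `R n = A n / A (n / p)` is `p`-integral, and modulo `p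
^ (e + 1)` it depends only on `n` modulo `p ^ (e + 1)`. The rest is Dwork's argument, which uses
only these properties and `A 0 = 1`. After clearing denominators, the coefficient at degree `a + p *
K` (with `a < p`) is the sum over `j < p ^ s`, `j ≤ K`, of `A j * A (K - j) * (R (a + p * (K - j)) -
R (a + p * j))`. Over all `j ≤ K` this sum vanishes by antisymmetry. Periodicity of `R` relates the
blocks of length `p ^ s` to one another, so each is divisible by `p ^ (s + 1)`
(`pow_dvd_dworkBlock`). -/

open Finset in
theorem sum_range_mul_eq {S : Type*} [AddCommMonoid S] (f : ℕ → S) (p M : ℕ) :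
    ∑ j ∈ range (M * p), f j = ∑ m ∈ range M, ∑ i ∈ range p, f (i + p * m) := by
  induction M with
  | zero => simp
  | succ M ih =>
    rw [add_mul, one_mul, sum_range_add, ih, sum_range_succ]
    congr 1
    exact sum_congr rfl fun i _ => by rw [add_comm, mul_comm]

/-! ### Dwork's block sums and their divisibility. -/

section DworkBlock

open Finset

variable {S : Type*} [CommRing S]

/-- The block sums in Dwork's argument, divided by the leading coefficient of the block. -/
def dworkBlock (p : ℕ) (A R : ℕ → S) (a K : ℕ) : ℕ → ℕ → S
  | 0, j => if j ≤ K then A (K - j) * (R (a + p * (K - j)) - R (a + p * j)) else 0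
  | t + 1, m => ∑ i ∈ range p, R (i + p * m) * dworkBlock p A R a K t (i + p * m)

variable {p : ℕ} {A R : ℕ → S}

theorem dworkBlock_eq_zero (a K : ℕ) (t m : ℕ) (h : K < m * p ^ t) :
    dworkBlock p A R a K t m = 0 := by
  induction t generalizing m with
  | zero => simp only [pow_zero, mul_one] at h; simp [dworkBlock, h]
  | succ t ih =>
    refine sum_eq_zero fun i _ => ?_
    rw [ih, mul_zero]
    calc K < m * p ^ (t + 1) := h
      _ = p * m * p ^ t := by ring
      _ ≤ (i + p * m) * p ^ t := Nat.mul_le_mul_right _ (Nat.le_add_left _ _)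

/-- Since `A (i + p * m) = R (i + p * m) * A m` for `i < p`, the factor `A m` comes out of each
block. -/
theorem sum_mul_dworkBlock (hA : ∀ n, A n = R n * A (n / p)) (a K t M : ℕ) :
    ∑ j ∈ range (M * p ^ t), A j * dworkBlock p A R a K 0 j =
      ∑ m ∈ range M, A m * dworkBlock p A R a K t m := by
  induction t generalizing M with
  | zero => simp
  | succ t ih =>
    rw [pow_succ', ← mul_assoc, ih, sum_range_mul_eq]
    refine sum_congr rfl fun m _ => ?_
    rw [dworkBlock, mul_sum]
    refine sum_congr rfl fun i hi => ?_
    have hi := mem_range.1 hi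
    rw [hA (i + p * m), Nat.add_mul_div_left _ _ (by omega), Nat.div_eq_of_lt hi, zero_add]
    ring

/-- The summand changes sign under `j ↦ K - j`. -/
theorem sum_range_succ_mul_dworkBlock_zero (a K : ℕ) :
    ∑ j ∈ range (K + 1), A j * dworkBlock p A R a K 0 j = 0 := by
  have h : ∀ j ∈ range (K + 1), A j * dworkBlock p A R a K 0 j =
      A j * A (K - j) * R (a + p * (K - j)) - A (K - j) * A j * R (a + p * j) := by
    intro j hj
    rw [dworkBlock, if_pos (by simpa [Nat.lt_succ_iff] using hj)]
    ring
  rw [sum_congr rfl h, sum_sub_distrib, sub_eq_zero,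
    ← sum_range_reflect (fun j => A j * A (K - j) * R (a + p * (K - j)))]
  refine sum_congr rfl fun j hj => ?_
  have hj := mem_range.1 hj
  rw [show K + 1 - 1 - j = K - j by omega, show K - (K - j) = j by omega]

theorem dvd_dworkBlock_shift
    (hR : ∀ e n m, (p : S) ^ (e + 1) ∣ R (n + m * p ^ (e + 1)) - R n) (a s : ℕ)
    (ih : ∀ t < s, ∀ K m, (p : S) ^ (t + 1) ∣ dworkBlock p A R a K t m) (K m : ℕ)
    (t : ℕ) (ht : t ≤ s) (j : ℕ) :
    (p : S) ^ (s + 1) ∣ dworkBlock p A R a (K + m * p ^ s) t (j + m * p ^ (s - t)) -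
      dworkBlock p A R a K t j := by
  induction t generalizing j with
  | zero =>
    -- Shifting `K` and `j` together preserves `K - j`, so only `R (a + p * j)` changes.
    simp only [dworkBlock, Nat.sub_zero, Nat.add_le_add_iff_right, Nat.add_sub_add_right]
    split_ifs
    · have h := (hR s (a + p * j) m).mul_left (- A (K - j))
      have e : a + p * j + m * p ^ (s + 1) = a + p * (j + m * p ^ s) := by ring
      rw [e] at h
      convert h using 1
      ring
    · simp
  | succ t iht =>
    simp only [dworkBlock]
    rw [← sum_sub_distrib]
    refine dvd_sum fun i _ => ?_
    have e : i + p * (j + m * p ^ (s - (t + 1))) = i + p * j + m * p ^ (s - t) := by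
      rw [show s - t = s - (t + 1) + 1 by omega]; ring
    rw [e]
    -- Split `R' * B' - R * B` as `R' * (B' - B) + (R' - R) * B`; the last product gains `s - t`
    -- powers from `R` and `t + 1` from the block.
    have h1 := (iht (by omega) (i + p * j)).mul_left (R (i + p * j + m * p ^ (s - t)))
    have h2 := hR (s - (t + 1)) (i + p * j) m
    rw [show s - (t + 1) + 1 = s - t by omega] at h2
    have h3 := mul_dvd_mul h2 (ih t (by omega) K (i + p * j))
    rw [← pow_add, show s - t + (t + 1) = s + 1 by omega] at h3
    convert h1.add h3 using 1
    ring

theorem pow_dvd_dworkBlock (hp : 0 < p) (hA : ∀ n, A n = R n * A (n / p)) (hA0 : A 0 = 1)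
    (hR : ∀ e n m, (p : S) ^ (e + 1) ∣ R (n + m * p ^ (e + 1)) - R n) (a s : ℕ) :
    ∀ K m, (p : S) ^ (s + 1) ∣ dworkBlock p A R a K s m := by
  induction s using Nat.strong_induction_on with
  | _ s ih =>
    have shift : ∀ K m, (p : S) ^ (s + 1) ∣ dworkBlock p A R a K s 0 →
        (p : S) ^ (s + 1) ∣ dworkBlock p A R a (K + m * p ^ s) s m := by
      intro K m h
      have := dvd_dworkBlock_shift hR a s ih K m s le_rfl 0
      rw [Nat.sub_self, pow_zero, mul_one, zero_add] at this
      exact (dvd_iff_dvd_of_dvd_sub this).2 h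
    have first : ∀ K, (p : S) ^ (s + 1) ∣ dworkBlock p A R a K s 0 := by
      intro K
      induction K using Nat.strong_induction_on with
      | _ K ihK =>
        have hsum : ∑ m ∈ range (K + 1), A m * dworkBlock p A R a K s m = 0 := by
          rw [← sum_mul_dworkBlock hA, ← sum_range_succ_mul_dworkBlock_zero a K (A := A) (R := R)]
          refine (sum_subset (range_subset_range.2
            (Nat.le_mul_of_pos_right _ (pow_pos hp s))) fun j _ hj => ?_).symm
          rw [dworkBlock_eq_zero, mul_zero]
          have hj := mem_range.not.1 hj
          rw [pow_zero, mul_one]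
          omega
        -- As `A 0 = 1`, the block `m = 0` is minus the combination of the others, which reduce by
        -- `shift` to block `0` for smaller `K`.
        rw [sum_range_succ', hA0, one_mul] at hsum
        rw [eq_neg_of_add_eq_zero_right hsum, dvd_neg]
        refine Finset.dvd_sum fun m _ => Dvd.dvd.mul_left ?_ (A (m + 1))
        rcases lt_or_ge K ((m + 1) * p ^ s) with h | h
        · rw [dworkBlock_eq_zero _ _ _ _ h]; exact dvd_zero _
        · have hpos : 0 < (m + 1) * p ^ s := by positivity
          have := shift _ (m + 1) (ihK (K - (m + 1) * p ^ s) (by omega))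
          rwa [Nat.sub_add_cancel h] at this
    intro K m
    rcases lt_or_ge K (m * p ^ s) with h | h
    · rw [dworkBlock_eq_zero _ _ _ _ h]; exact dvd_zero _
    · have := shift _ m (first (K - m * p ^ s))
      rwa [Nat.sub_add_cancel h] at this

end DworkBlock

/-! ### From block sums to congruences of power series. -/

theorem PowerSeries.coeff_mul_expand {S : Type*} [CommRing S] {p : ℕ} (hp : p ≠ 0)
    (f g : PowerSeries S) (a K : ℕ) (ha : a < p) :
    coeff (a + p * K) (f * expand p hp g) =
      ∑ j ∈ Finset.range (K + 1), coeff (a + p * (K - j)) f * coeff j g := by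
  rw [mul_comm f, coeff_mul, Finset.Nat.sum_antidiagonal_eq_sum_range_succ
    (fun i j => coeff i (expand p hp g) * coeff j f)]
  have hinj : Set.InjOn (fun j => p * j) (Finset.range (K + 1) : Set ℕ) :=
    fun x _ y _ h => Nat.eq_of_mul_eq_mul_left (Nat.pos_of_ne_zero hp) h
  rw [← Finset.sum_subset (s₁ := (Finset.range (K + 1)).image (fun j => p * j)),
    Finset.sum_image hinj]
  · refine Finset.sum_congr rfl fun j hj => ?_
    have hj : j ≤ K := Nat.lt_succ_iff.1 (Finset.mem_range.1 hj)
    have : p * j ≤ p * K := Nat.mul_le_mul_left _ hj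
    rw [coeff_expand_mul, Nat.mul_sub, Nat.add_sub_assoc this, mul_comm]
  · intro x hx
    obtain ⟨j, hj, rfl⟩ := Finset.mem_image.1 hx
    have hj : j ≤ K := Nat.lt_succ_iff.1 (Finset.mem_range.1 hj)
    have : p * j ≤ p * K := Nat.mul_le_mul_left _ hj
    exact Finset.mem_range.2 (by omega)
  · intro x hx hx'
    rw [coeff_expand_of_not_dvd, zero_mul]
    rintro ⟨j, rfl⟩
    refine hx' (Finset.mem_image.2 ⟨j, Finset.mem_range.2 ?_, rfl⟩)
    by_contra! h
    have h1 : p * (K + 1) ≤ p * j := Nat.mul_le_mul_left _ h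
    have h2 := Finset.mem_range.1 hx
    rw [mul_add, mul_one] at h1
    omega

theorem PowerSeries.natCast_pow_dvd {S : Type*} [CommRing S] {p s : ℕ} {f : PowerSeries S}
    (h : ∀ n, (p : S) ^ s ∣ coeff n f) : (p : PowerSeries S) ^ s ∣ f := by
  choose c hc using h
  refine ⟨PowerSeries.mk c, ?_⟩
  ext n
  rw [← map_natCast (C (R := S)), ← map_pow, coeff_C_mul, coeff_mk, hc]

/-- Dwork's congruences for a sequence whose ratios `A n / A (n / p)` are integral and
`p`-adically Lipschitz. -/
theorem PowerSeries.pow_dvd_mul_trunc_expand_sub {S : Type*} [CommRing S] {p : ℕ} (hp : p ≠ 0)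
    {A R : ℕ → S} (hA : ∀ n, A n = R n * A (n / p)) (hA0 : A 0 = 1)
    (hR : ∀ e n m, (p : S) ^ (e + 1) ∣ R (n + m * p ^ (e + 1)) - R n) (s : ℕ) :
    (p : PowerSeries S) ^ (s + 1) ∣
      mk A * expand p hp (trunc (p ^ s) (mk A) : PowerSeries S) -
        (trunc (p ^ (s + 1)) (mk A) : PowerSeries S) * expand p hp (mk A) := by
  refine natCast_pow_dvd fun N => ?_
  have hp0 : 0 < p := Nat.pos_of_ne_zero hp
  obtain ⟨a, K, ha, rfl⟩ : ∃ a K, a < p ∧ N = a + p * K :=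
    ⟨N % p, N / p, Nat.mod_lt _ hp0, (Nat.mod_add_div N p).symm⟩
  have key := pow_dvd_dworkBlock hp0 hA hA0 hR a s K 0
  -- The coefficient is the single block `m = 0` of length `p ^ s`.
  have hsum := sum_mul_dworkBlock (R := R) hA a K s 1
  rw [Finset.sum_range_one, hA0, one_mul, one_mul] at hsum
  rw [← hsum] at key
  convert key using 1
  rw [map_sub, coeff_mul_expand hp _ _ a K ha, coeff_mul_expand hp _ _ a K ha,
    ← Finset.sum_range_reflect (fun j => _ * coeff j (mk A)), ← Finset.sum_sub_distrib]
  have hlt : ∀ j, a + p * j < p ^ (s + 1) ↔ j < p ^ s := by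
    intro j
    rw [pow_succ, ← Nat.div_lt_iff_lt_mul hp0, Nat.add_mul_div_left _ _ hp0,
      Nat.div_eq_of_lt ha, zero_add]
  have hT : ∀ m j, coeff j (trunc m (mk A) : PowerSeries S) = if j < m then A j else 0 := by
    intro m j
    rw [Polynomial.coeff_coe, coeff_trunc, coeff_mk]
  have e1 : ∀ j ∈ Finset.range (K + 1),
      coeff (a + p * (K - j)) (mk A) * coeff j (trunc (p ^ s) (mk A) : PowerSeries S) -
        coeff (a + p * (K - (K + 1 - 1 - j))) (trunc (p ^ (s + 1)) (mk A) : PowerSeries S) *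
          coeff (K + 1 - 1 - j) (mk A) =
      if j < p ^ s then A j * dworkBlock p A R a K 0 j else 0 := by
    intro j hj
    have hj : j ≤ K := Nat.lt_succ_iff.1 (Finset.mem_range.1 hj)
    rw [hT, hT, Nat.add_sub_cancel, Nat.sub_sub_self hj, coeff_mk, coeff_mk]
    simp only [hlt]
    split_ifs
    · have hdiv : ∀ i, A (a + p * i) = R (a + p * i) * A i := by
        intro i
        rw [hA, Nat.add_mul_div_left _ _ hp0, Nat.div_eq_of_lt ha, zero_add]
      rw [dworkBlock, if_pos hj, hdiv, hdiv]
      ring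
    · ring
  rw [Finset.sum_congr rfl e1, ← Finset.sum_filter]
  refine Finset.sum_subset ?_ ?_
  · intro j hj
    exact Finset.mem_range.2 (Finset.mem_filter.1 hj).2
  · intro j hj hj'
    rw [dworkBlock_eq_zero, mul_zero]
    by_contra h
    refine hj' (Finset.mem_filter.2 ⟨Finset.mem_range.2 ?_, Finset.mem_range.1 hj⟩)
    rw [pow_zero, mul_one] at h
    omega

theorem dworkCongruence_mk {p : ℕ} [hp : Fact p.Prime] {A R : ℕ → ℤ_[p]}
    (hA : ∀ n, A n = R n * A (n / p)) (hA0 : A 0 = 1)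
    (hR : ∀ e n m, (p : ℤ_[p]) ^ (e + 1) ∣ R (n + m * p ^ (e + 1)) - R n) (s : ℕ) :
    DworkCongruence p (PowerSeries.mk A) (s + 1) := by
  have h := PowerSeries.pow_dvd_mul_trunc_expand_sub hp.out.ne_zero hA hA0 hR s
  have hc : PowerSeries.constantCoeff (PowerSeries.mk A) = 1 := by
    rw [← PowerSeries.coeff_zero_eq_constantCoeff_apply, PowerSeries.coeff_mk, hA0]
  have hct : PowerSeries.constantCoeff
      (PowerSeries.trunc (p ^ s) (PowerSeries.mk A) : PowerSeries ℤ_[p]) = 1 := by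
    rw [← PowerSeries.coeff_zero_eq_constantCoeff_apply, Polynomial.coeff_coe,
      PowerSeries.coeff_trunc, if_pos (pow_pos hp.out.pos s), PowerSeries.coeff_mk, hA0]
  have h1 := PowerSeries.mul_invOfUnit
    (PowerSeries.expand p hp.out.ne_zero (PowerSeries.mk A)) 1
    (by rw [PowerSeries.constantCoeff_expand, hc, Units.val_one])
  have h2 := PowerSeries.mul_invOfUnit
    (PowerSeries.expand p hp.out.ne_zero
      (PowerSeries.trunc (p ^ s) (PowerSeries.mk A) : PowerSeries ℤ_[p])) 1
    (by rw [PowerSeries.constantCoeff_expand, hct, Units.val_one])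
  unfold DworkCongruence seriesQuotient
  rw [Nat.add_sub_cancel]
  generalize PowerSeries.expand p hp.out.ne_zero (PowerSeries.mk A) = G at *
  generalize PowerSeries.expand p hp.out.ne_zero
    (PowerSeries.trunc (p ^ s) (PowerSeries.mk A) : PowerSeries ℤ_[p]) = G' at *
  convert h.mul_right (PowerSeries.invOfUnit G 1 * PowerSeries.invOfUnit G' 1) using 1
  linear_combination (-PowerSeries.mk A * PowerSeries.invOfUnit G 1) * h2 +
    ((PowerSeries.trunc (p ^ (s + 1)) (PowerSeries.mk A) : PowerSeries ℤ_[p]) *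
      PowerSeries.invOfUnit G' 1) * h1

/-! ### Factorials and multinomials modulo powers of `p`. -/

/-- The product of the positive integers up to `n` which are prime to `p`. -/
def coprimeFactorial (p n : ℕ) : ℕ :=
  ∏ i ∈ Finset.range n, if p ∣ i + 1 then 1 else i + 1

theorem coprimeFactorial_succ (p n : ℕ) :
    coprimeFactorial p (n + 1) = coprimeFactorial p n * if p ∣ n + 1 then 1 else n + 1 :=
  Finset.prod_range_succ _ _

theorem not_dvd_coprimeFactorial {p : ℕ} (hp : p.Prime) (n : ℕ) : ¬ p ∣ coprimeFactorial p n := by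
  rw [coprimeFactorial, hp.prime.dvd_finsetProd_iff]
  rintro ⟨i, -, hi⟩
  split_ifs at hi with h
  · exact hp.one_lt.ne' (Nat.dvd_one.1 hi)
  · exact h hi

theorem factorial_eq_coprimeFactorial {p : ℕ} (hp : 0 < p) (n : ℕ) :
    n ! = coprimeFactorial p n * p ^ (n / p) * (n / p)! := by
  induction n with
  | zero => simp [coprimeFactorial]
  | succ n ih =>
    rw [Nat.factorial_succ, ih, coprimeFactorial_succ, Nat.succ_div]
    split_ifs with h
    · obtain ⟨c, hc⟩ := h
      have hc' : n / p + 1 = c := by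
        have := Nat.succ_div (a := n) (b := p)
        rw [if_pos ⟨c, hc⟩, hc, Nat.mul_div_cancel_left _ hp] at this
        exact this.symm
      rw [Nat.factorial_succ, hc', hc, ← hc']
      ring
    · rw [add_zero]
      ring

/-- For `e ≠ 0`, a shift by `p ^ e` preserves both the factors modulo `p ^ e` and which of them are
omitted. -/
theorem coprimeFactorial_add_mul_modEq {p e : ℕ} (he : e ≠ 0) (n m : ℕ) :
    coprimeFactorial p (n + m * p ^ e) ≡
      coprimeFactorial p n * coprimeFactorial p (p ^ e) ^ m [MOD p ^ e] := by
  have step : ∀ n, coprimeFactorial p (n + p ^ e) ≡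
      coprimeFactorial p n * coprimeFactorial p (p ^ e) [MOD p ^ e] := by
    intro n
    induction n with
    | zero => simp [coprimeFactorial, Nat.ModEq.refl]
    | succ n ih =>
      rw [add_right_comm, coprimeFactorial_succ, coprimeFactorial_succ, add_right_comm,
        mul_right_comm]
      simp only [← Nat.dvd_add_iff_left (dvd_pow_self p he)]
      refine ih.mul ?_
      split_ifs
      · exact Nat.ModEq.refl _
      · simp [Nat.ModEq]
  induction m with
  | zero => simp [Nat.ModEq.refl]
  | succ m ih =>
    rw [add_mul, one_mul, ← add_assoc, pow_succ, ← mul_assoc]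
    exact (step _).trans (ih.mul_right _)

theorem ascFactorial_modEq {a b q : ℕ} (h : a ≡ b [MOD q]) (r : ℕ) :
    a.ascFactorial r ≡ b.ascFactorial r [MOD q] := by
  induction r with
  | zero => exact Nat.ModEq.refl _
  | succ r ih => exact (h.add_right r).mul ih

/-- For `r > 0` the prefactor supplies the extra `p`; for `r = 0` both sides are `1`. This recovers
the power lost when `n` is replaced by `n / p`. -/
theorem pow_mul_ascFactorial_modEq {p x y e : ℕ} (h : x ≡ y [MOD p ^ e]) (r : ℕ) :
    p ^ r * x.ascFactorial r ≡ p ^ r * y.ascFactorial r [MOD p ^ (e + 1)] := by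
  cases r with
  | zero => exact Nat.ModEq.refl _
  | succ r =>
    rw [pow_succ p r, pow_succ' p e, mul_assoc, mul_assoc]
    exact ((ascFactorial_modEq h _).mul_left' p).mul_left _

/-- The multinomial coefficient `(kn)! / (n!) ^ k`. -/
def equalMultinomial (k n : ℕ) : ℕ := (k * n)! / n ! ^ k

theorem equalMultinomial_mul (k n : ℕ) : equalMultinomial k n * n ! ^ k = (k * n)! := by
  refine Nat.div_mul_cancel ?_
  simpa using Nat.prod_factorial_dvd_factorial_sum (Finset.range k) (fun _ => n)

/-- The `p`-integral factor in the ratio of `equalMultinomial k n` and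
`equalMultinomial k (n / p)`. -/
def equalMultinomialRatio (p k n : ℕ) : ℕ :=
  coprimeFactorial p (k * n) *
    (p ^ (k * (n % p) / p) * (k * (n / p) + 1).ascFactorial (k * (n % p) / p))

theorem equalMultinomial_mul_coprimeFactorial {p : ℕ} (hp : 0 < p) (k n : ℕ) :
    equalMultinomial k n * coprimeFactorial p n ^ k =
      equalMultinomialRatio p k n * equalMultinomial k (n / p) := by
  have h := equalMultinomial_mul k n
  have hk : k * n / p = k * (n / p) + k * (n % p) / p := by
    conv_lhs => rw [← Nat.div_add_mod n p]
    rw [mul_add, mul_left_comm, Nat.mul_add_div hp]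
  rw [factorial_eq_coprimeFactorial hp n, factorial_eq_coprimeFactorial hp (k * n), hk,
    ← Nat.factorial_mul_ascFactorial, ← equalMultinomial_mul k (n / p)] at h
  have hpos : 0 < p ^ (k * (n / p)) * (n / p)! ^ k := by positivity
  refine Nat.eq_of_mul_eq_mul_right hpos ?_
  rw [equalMultinomialRatio]
  calc _ = equalMultinomial k n * (coprimeFactorial p n * p ^ (n / p) * (n / p)!) ^ k := by
        rw [mul_pow, mul_pow, ← pow_mul, mul_comm (n / p) k]; ring
    _ = _ := by rw [h, pow_add]; ring

theorem equalMultinomialRatio_modEq {p : ℕ} (hp : 0 < p) (k e n m : ℕ) :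
    equalMultinomialRatio p k (n + m * p ^ (e + 1)) ≡
      equalMultinomialRatio p k n * coprimeFactorial p (p ^ (e + 1)) ^ (k * m)
        [MOD p ^ (e + 1)] := by
  have hs : m * p ^ (e + 1) = p * (m * p ^ e) := by ring
  have hmod : (n + m * p ^ (e + 1)) % p = n % p := by rw [hs, Nat.add_mul_mod_self_left]
  have hdiv : (n + m * p ^ (e + 1)) / p = n / p + m * p ^ e := by
    rw [hs, Nat.add_mul_div_left _ _ hp]
  rw [equalMultinomialRatio, equalMultinomialRatio, hmod, hdiv, mul_right_comm]
  refine Nat.ModEq.mul ?_ (pow_mul_ascFactorial_modEq ?_ _)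
  · rw [mul_add, ← mul_assoc]
    exact coprimeFactorial_add_mul_modEq (Nat.add_one_ne_zero e) _ _
  · rw [mul_add, ← mul_assoc, add_right_comm]
    simp [Nat.ModEq]

/-! ### The ratio `R` in `ℤ_[p]`. -/

section Padic

variable {p : ℕ} [hp : Fact p.Prime]

theorem PadicInt.isUnit_natCast_of_not_dvd {n : ℕ} (h : ¬ p ∣ n) : IsUnit (n : ℤ_[p]) := by
  rw [PadicInt.isUnit_iff, PadicInt.norm_natCast_eq_one_iff]
  exact (hp.out.coprime_iff_not_dvd).2 h

theorem PadicInt.pow_dvd_iff_toZModPow_eq {s : ℕ} {x y : ℤ_[p]} :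
    (p : ℤ_[p]) ^ s ∣ x - y ↔ PadicInt.toZModPow s x = PadicInt.toZModPow s y := by
  rw [← Ideal.mem_span_singleton, ← PadicInt.ker_toZModPow, RingHom.mem_ker, map_sub, sub_eq_zero]

theorem exists_padicInt_equalMultinomial {k : ℕ} (hpk : ¬ p ∣ k) :
    ∃ A R : ℕ → ℤ_[p], (∀ n, A n * (k : ℤ_[p]) ^ (k * n) = equalMultinomial k n) ∧
      (∀ n, A n = R n * A (n / p)) ∧
      ∀ e n m, (p : ℤ_[p]) ^ (e + 1) ∣ R (n + m * p ^ (e + 1)) - R n := by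
  have hp0 := hp.out.pos
  obtain ⟨w, hw⟩ := (PadicInt.isUnit_natCast_of_not_dvd hpk).exists_left_inv
  choose v hv using fun n =>
    (PadicInt.isUnit_natCast_of_not_dvd (not_dvd_coprimeFactorial hp.out n)).exists_left_inv
  have hwpow : ∀ n, w ^ n * (k : ℤ_[p]) ^ n = 1 := fun n => by rw [← mul_pow, hw, one_pow]
  have hvpow : ∀ n, v n ^ k * (coprimeFactorial p n : ℤ_[p]) ^ k = 1 := fun n => by
    rw [← mul_pow, hv, one_pow]
  refine ⟨fun n => equalMultinomial k n * w ^ (k * n),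
    fun n => equalMultinomialRatio p k n * v n ^ k * w ^ (k * (n - n / p)), ?_, ?_, ?_⟩
  · intro n
    rw [mul_assoc, hwpow, mul_one]
  · intro n
    have h := congrArg (Nat.cast : ℕ → ℤ_[p]) (equalMultinomial_mul_coprimeFactorial hp0 k n)
    push_cast at h
    have hn : k * n = k * (n - n / p) + k * (n / p) := by
      rw [← mul_add, Nat.sub_add_cancel (Nat.div_le_self n p)]
    simp only
    rw [hn, pow_add]
    linear_combination (v n ^ k * w ^ (k * (n - n / p)) * w ^ (k * (n / p))) * h -
      (equalMultinomial k n * w ^ (k * (n - n / p)) * w ^ (k * (n / p)) : ℤ_[p]) * hvpow n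
  · intro e n m
    rw [PadicInt.pow_dvd_iff_toZModPow_eq]
    have hpow : p ^ (e + 1) = Nat.totient (p ^ (e + 1)) + p ^ e := by
      rw [Nat.totient_prime_pow_succ hp.out, ← Nat.mul_succ, Nat.succ_eq_add_one,
        Nat.sub_add_cancel hp0, pow_succ]
    have hexp : k * (n + m * p ^ (e + 1) - (n + m * p ^ (e + 1)) / p) =
        k * (n - n / p) + Nat.totient (p ^ (e + 1)) * (k * m) := by
      have hle := Nat.div_le_self n p
      have h1 : n + m * p ^ (e + 1) - (n + m * p ^ (e + 1)) / p =
          (n - n / p) + m * Nat.totient (p ^ (e + 1)) := by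
        rw [show m * p ^ (e + 1) = p * (m * p ^ e) by ring, Nat.add_mul_div_left _ _ hp0,
          show p * (m * p ^ e) = m * p ^ (e + 1) by ring]
        conv_lhs => rw [hpow, mul_add]
        omega
      rw [h1]
      ring
    -- By `hexp` the exponent of `w = 1 / k` moves by a multiple of the totient, so Euler's theorem
    -- removes the change.
    have hw1 : PadicInt.toZModPow (e + 1) w ^ Nat.totient (p ^ (e + 1)) = 1 := by
      have hu : IsUnit (PadicInt.toZModPow (e + 1) w) := (IsUnit.of_mul_eq_one _ hw).map _
      rw [← hu.unit_spec, ← Units.val_pow_eq_pow_val, ZMod.pow_totient, Units.val_one]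
    have hr := (ZMod.natCast_eq_natCast_iff _ _ _).2 (equalMultinomialRatio_modEq hp0 k e n m)
    have hq := (ZMod.natCast_eq_natCast_iff _ _ _).2
      (coprimeFactorial_add_mul_modEq (p := p) (Nat.add_one_ne_zero e) n m)
    have hv1 := congrArg (PadicInt.toZModPow (e + 1)) (hvpow n)
    have hv2 := congrArg (PadicInt.toZModPow (e + 1)) (hvpow (n + m * p ^ (e + 1)))
    push_cast at hr hq
    simp only [map_mul, map_pow, map_natCast, map_one] at hv1 hv2 ⊢
    rw [hq, mul_pow, ← pow_mul, mul_comm m k] at hv2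
    rw [hexp, pow_add (PadicInt.toZModPow (e + 1) w), pow_mul _ (Nat.totient (p ^ (e + 1))), hw1,
      one_pow, mul_one, hr]
    congr 1
    -- Numerator and denominator acquire the same factor `P`, which cancels without being evaluated.
    generalize (coprimeFactorial p (p ^ (e + 1)) : ZMod (p ^ (e + 1))) ^ (k * m) = P at *
    generalize PadicInt.toZModPow (e + 1) (v (n + m * p ^ (e + 1))) ^ k = V' at *
    generalize PadicInt.toZModPow (e + 1) (v n) ^ k = V at *
    linear_combination
      (equalMultinomialRatio p k n : ZMod (p ^ (e + 1))) * V * hv2 -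
        (equalMultinomialRatio p k n : ZMod (p ^ (e + 1))) * P * V' * hv1

end Padic

/-! ### The hypergeometric coefficients. -/

theorem prod_range_ascPochhammer_eval_div {k : ℕ} (hk : 1 ≤ k) (l : ℕ) :
    (∏ i ∈ Finset.range (k - 1), (ascPochhammer ℚ l).eval (((i : ℕ) + 1 : ℚ) / k)) * l ! *
      (k : ℚ) ^ (k * l) = ((k * l)! : ℕ) := by
  obtain ⟨k, rfl⟩ := Nat.exists_eq_add_of_le' hk
  have hk0 : ((k + 1 : ℕ) : ℚ) ≠ 0 := by positivity
  -- Here `l!` is the missing last Pochhammer factor, at argument `1`.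
  have h1 : (l ! : ℚ) = (ascPochhammer ℚ l).eval (((k : ℕ) + 1 : ℚ) / (k + 1 : ℕ)) := by
    rw [← Nat.cast_succ, div_self hk0, ascPochhammer_eval_one]
  rw [Nat.add_sub_cancel, h1, ← Finset.prod_range_succ
    (fun i => (ascPochhammer ℚ l).eval (((i : ℕ) + 1 : ℚ) / (k + 1 : ℕ)))]
  clear h1
  induction l with
  | zero => simp
  | succ l ih =>
    simp only [ascPochhammer_succ_eval]
    rw [Finset.prod_mul_distrib, mul_add, mul_one, pow_add, ← Nat.factorial_mul_ascFactorial,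
      Nat.cast_mul, ← ih, Nat.ascFactorial_eq_prod_range, Nat.cast_prod]
    have h2 : (∏ i ∈ Finset.range (k + 1), (((i : ℕ) + 1 : ℚ) / (k + 1 : ℕ) + l)) *
        ((k + 1 : ℕ) : ℚ) ^ (k + 1) =
        ∏ i ∈ Finset.range (k + 1), (((k + 1) * l + 1 + i : ℕ) : ℚ) := by
      rw [Finset.pow_eq_prod_const, ← Finset.prod_mul_distrib]
      refine Finset.prod_congr rfl fun i _ => ?_
      rw [add_mul, div_mul_cancel₀ _ hk0]
      push_cast
      ring
    rw [← h2]
    ring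

theorem coeff_hypergeometricFracSeries {k : ℕ} (hk : 2 ≤ k) (l : ℕ) :
    PowerSeries.coeff l (hypergeometricFracSeries k) * (k : ℚ) ^ (k * l) =
      equalMultinomial k l := by
  have h := prod_range_ascPochhammer_eval_div (show 1 ≤ k by omega) l
  rw [← equalMultinomial_mul, Nat.cast_mul, Nat.cast_pow,
    ← Fin.prod_univ_eq_prod_range
      (fun i => (ascPochhammer ℚ l).eval (((i : ℕ) + 1 : ℚ) / k))] at h
  have hl : (l ! : ℚ) ≠ 0 := by exact_mod_cast l.factorial_ne_zero
  rw [hypergeometricFracSeries, hypergeometricSeries, PowerSeries.coeff_mk]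
  simp only [ascPochhammer_eval_one, Finset.prod_const, Finset.card_univ, Fintype.card_fin]
  obtain ⟨k, rfl⟩ := Nat.exists_eq_add_of_le' hk
  rw [Nat.add_sub_cancel, ← pow_succ, div_mul_eq_mul_div, div_eq_iff (pow_ne_zero _ hl)]
  refine mul_right_cancel₀ hl ?_
  linear_combination h

theorem mainTheorem4 (k : ℕ) (hk : 2 ≤ k) (p : ℕ) [Fact p.Prime] (hp : p ≠ 2) (hpk : ¬ p ∣ k) :
    ∃ F : PowerSeries ℤ_[p],
      PowerSeries.map (algebraMap ℤ_[p] ℚ_[p]) F =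
        PowerSeries.map (algebraMap ℚ ℚ_[p]) (hypergeometricFracSeries k) ∧
      PowerSeries.constantCoeff F = 1 ∧
      ∀ s : ℕ, 1 ≤ s → DworkCongruence p F s := by
  obtain ⟨A, R, hAk, hA, hR⟩ := exists_padicInt_equalMultinomial hpk
  have hA0 : A 0 = 1 := by simpa [equalMultinomial] using hAk 0
  refine ⟨PowerSeries.mk A, ?_, ?_, ?_⟩
  · ext l
    have hk0 : (k : ℚ_[p]) ^ (k * l) ≠ 0 := pow_ne_zero _ (Nat.cast_ne_zero.2 (by omega))
    have h1 := congrArg (algebraMap ℤ_[p] ℚ_[p]) (hAk l)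
    have h2 := congrArg (algebraMap ℚ ℚ_[p]) (coeff_hypergeometricFracSeries hk l)
    simp only [map_mul, map_pow, map_natCast] at h1 h2
    rw [PowerSeries.coeff_map, PowerSeries.coeff_map, PowerSeries.coeff_mk]
    exact mul_right_cancel₀ hk0 (h1.trans h2.symm)
  · rw [← PowerSeries.coeff_zero_eq_constantCoeff_apply, PowerSeries.coeff_mk, hA0]
  · intro s hs
    obtain ⟨s, rfl⟩ := Nat.exists_eq_add_of_le' hs
    exact dworkCongruence_mk hA hA0 hR s
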